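/- **Setting.** A database $D$ has $n$ rows over $m \ge 1$ attributes; $n$ is public. A public (data-independent) map bins the raw values of the $j$-th attribute into $s_j$ discrete values. The binary version $D_{\mathsf B}$ of $D$ has $d=\sum_j s_j$ binary columns, one for each value of each attribute (dummy coding). Two databases are neighbours if they differ in one row. A randomized algorithm $\mathcal M$ is $(\epsilon,\delta)$-differentially private (DP) if $\mathbb P(\mathcal M(D)\in S)\le e^{\epsilon}\,\mathbb P(\mathcal M(D')\in S)+\delta$ for all neighbours $D,D'$ and all $S$. **The mechanism with budget $\epsilon'>0$.** 1. *One-way margins.* For each attribute $j$, compute the histogram of its values (the number of ones in each of its binary columns) and add independent $\mathrm{Lap}(2/\epsilon')$ noise to each bin. For each binary column $X$ of the attribute deduce the noisy counts $\tilde n^1$ (its own bin) and $\tilde n^0$ (the sum of the other bins), negative noisy bins being set to $0$, and the margin $\tilde F(0)=\tilde n^0/(\tilde n^0+\tilde n^1)$, $\tilde F(1)=1$. 2. *Two-way positive conjunctions.* For each pair of attributes $i<j$, compute the histogram of the pairs of values and add independent $\mathrm{Lap}(2/\epsilon')$ noise to each cell. For each pair of binary columns $X,Y$ of the two attributes deduce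 the noisy counts $\tilde n^{ab}$ of $(X,Y)=(a,b)$ by summing cells, and $\tilde{\mathbb E}(XY)=\tilde n^{11}/\sum_{a,b}\tilde n^{ab}$; for two columns of the same attribute it is $0$. 3. *Copula construction.* With $\tilde\mu=1-\tilde F(0)$ and variance $\tilde\mu(1-\tilde\mu)$, form the Pearson correlations $\tilde r$ of all pairs of columns. By a bisection search find the Gaussian correlations $\rho$ for which the numerically integrated $\iint \tilde F_c^{-1}(\Phi(y))\,\tilde F_{c'}^{-1}(\Phi(z))\,\mathbf\Phi_{\rho}(y,z)\,dy\,dz$ (with $\mathbf\Phi_\rho$ the standard bivariate normal density of correlation $\rho$, step $0.01$, limits $\pm10$) matches $\tilde r\sqrt{\mathrm{var}\,\mathrm{var}'}+\tilde\mu\tilde\mu'$. Apply to the matrix $\mathbf P$ of the $\rho$'s the alternating-projection nearest-correlation-matrix iteration, and replace nonpositive eigenvalues by a small positive value, giving $\mathbf P'$. 4. *Sampling.* Draw an $n\times d$ matrix $\mathbf Z$ of independent standard normal variables, set $\mathbf Y=\mathbf Z\mathbf L$ with the Cholesky factor $\mathbf L^{T}\mathbf L=\mathbf P'$, and output the binary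 dataset with entries $\tilde F_c^{-1}(\Phi(Y_c^{(k)}))$, where $\tilde F_c^{-1}(t)=0$ for $t\le\tilde F_c(0)$ and $1$ otherwise. **Claim (privacy of the scheme).** Let $\epsilon>0$, $\delta\in(0,1)$ and $m'=m+\binom m2$, which is the number of computations in steps 1 and 2 (one for each attribute and one for each pair of attributes). There is exactly one $\epsilon'>0$ with $$\sqrt{2m'\ln(1/\delta)}\;\epsilon'+m'\epsilon'(e^{\epsilon'}-1)=\epsilon ,$$ and it is of order $1/\sqrt{m'}$: it lies between $c_1/\sqrt{m'}$ and $c_2/\sqrt{m'}$ with positive constants $c_1,c_2$ that depend only on $\epsilon,\delta$. For this $\epsilon'$: - each of the $m$ computations of one-way margins and each of the $\binom m2$ computations of two-way positive conjunctions is $(\epsilon',0)$-DP (both the noisy histogram and the quantities deduced from it); - all noisy histograms released together are $(\epsilon,\delta)$-DP, and so is every randomized function of them whose coins are independent of the database and of the Laplace noise; - in particular the full mechanism, whose output is the synthetic dataset, is $(\epsilon,\delta)$-DP, for any number of bisection steps, any number of iterations of the nearest-correlation-matrix algorithm and any positive replacement value for the eigenvalues. -/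

import Mathlib

open MeasureTheory ProbabilityTheory
open scoped ENNReal

namespace CopulaDP

/-! ### Differential privacy -/

/-- Two `n`-row databases are neighbours if they differ in exactly one row. -/
def Neighbors {X : Type*} {n : ℕ} (D D' : Fin n → X) : Prop :=
  ∃ i, D i ≠ D' i ∧ ∀ k, k ≠ i → D k = D' k

/-- `(ε, δ)`-differential privacy of a randomized algorithm `M`, which is given as a function of the
database and of its random coins `ω ∼ P`. Every subset `S` of the range is admitted; if the event is
not measurable, `P` is the outer measure, so no measurability of `M` is needed for the condition to
be at least as strong as the one over measurable events. -/
def IsDP {X Ω R : Type*} [MeasurableSpace Ω] {n : ℕ} (P : Measure Ω)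
    (M : (Fin n → X) → Ω → R) (ε δ : ℝ) : Prop :=
  ∀ D D' : Fin n → X, Neighbors D D' → ∀ S : Set R,
    P {ω | M D ω ∈ S} ≤
      ENNReal.ofReal (Real.exp ε) * P {ω | M D' ω ∈ S} + ENNReal.ofReal δ

/-- The Laplace distribution with mean `0` and scale `b`. -/
noncomputable def laplace (b : ℝ) : Measure ℝ :=
  volume.withDensity fun x => ENNReal.ofReal (1 / (2 * b) * Real.exp (-|x| / b))

/-- The overall `ε` of `k`-fold advanced composition of `ε'`-differentially private mechanisms. -/
noncomputable def advEps (k : ℕ) (δ ε' : ℝ) : ℝ :=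
  Real.sqrt (2 * k * Real.log (1 / δ)) * ε' + k * ε' * (Real.exp ε' - 1)

/-! ### Pre-processing: binning and dummy coding

The `j`-th attribute has raw values in `U j`; a public map `bin j` sends them to `s j` discrete
values. The binary version of the database has `d = ∑ j, s j` columns. -/

/-- The binary columns. -/
abbrev Col {m : ℕ} (s : Fin m → ℕ) : Type := Fin (∑ j, s j)

/-- The pair (attribute, value of that attribute) that a binary column stands for. Columns are
ordered attribute by attribute. -/
def colInfo {m : ℕ} {s : Fin m → ℕ} (c : Col s) : (j : Fin m) × Fin (s j) :=
  finSigmaFinEquiv.symm c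

/-- The column of a value `a` of the attribute `j`. -/
def colOf {m : ℕ} {s : Fin m → ℕ} (j : Fin m) (a : Fin (s j)) : Col s :=
  finSigmaFinEquiv ⟨j, a⟩

/-- The binary version `D_B` of a database `D`. -/
def dummy {m n : ℕ} {s : Fin m → ℕ} {U : Fin m → Type*} (bin : ∀ j, U j → Fin (s j))
    (D : Fin n → ∀ j, U j) : Fin n → Col s → Bool :=
  fun k c => decide (bin (colInfo c).1 (D k (colInfo c).1) = (colInfo c).2)

/-! ### Differentially private statistics -/

/-- Unordered pairs of distinct attributes, written as `i < j`. -/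
abbrev AttrPair (m : ℕ) : Type := {p : Fin m × Fin m // p.1 < p.2}

/-- For each attribute, one real number for each of its values. -/
abbrev OneWay {m : ℕ} (s : Fin m → ℕ) : Type := ∀ j : Fin m, Fin (s j) → ℝ

/-- For each pair of attributes, one real number for each pair of their values. -/
abbrev TwoWay {m : ℕ} (s : Fin m → ℕ) : Type :=
  ∀ p : AttrPair m, Fin (s p.1.1) × Fin (s p.1.2) → ℝ

/-- The exact number of rows with the value `a` of the attribute `j`. -/
def countOne {m n : ℕ} {s : Fin m → ℕ} (B : Fin n → Col s → Bool) (j : Fin m) (a : Fin (s j)) :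
    ℕ :=
  (Finset.univ.filter fun k => B k (colOf j a) = true).card

/-- The exact number of rows with the pair of values `q` of the pair of attributes `p`. -/
def countTwo {m n : ℕ} {s : Fin m → ℕ} (B : Fin n → Col s → Bool) (p : AttrPair m)
    (q : Fin (s p.1.1) × Fin (s p.1.2)) : ℕ :=
  (Finset.univ.filter fun k =>
    B k (colOf p.1.1 q.1) = true ∧ B k (colOf p.1.2 q.2) = true).card

/-- The joint law of all Laplace variables: independent, all of scale `2 / ε'`, one for each value
of each attribute, and one for each pair of values of each pair of attributes. -/
noncomputable def noise {m : ℕ} (s : Fin m → ℕ) (ε' : ℝ) : Measure (OneWay s × TwoWay s) :=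
  (Measure.pi fun j : Fin m => Measure.pi fun _ : Fin (s j) => laplace (2 / ε')).prod
    (Measure.pi fun p : AttrPair m =>
      Measure.pi fun _ : Fin (s p.1.1) × Fin (s p.1.2) => laplace (2 / ε'))

/-- The noisy histogram of the attribute `j`. -/
def noisyOne {m n : ℕ} {s : Fin m → ℕ} {U : Fin m → Type*} (bin : ∀ j, U j → Fin (s j))
    (j : Fin m) (D : Fin n → ∀ j, U j) (ω : OneWay s × TwoWay s) : Fin (s j) → ℝ :=
  fun a => countOne (dummy bin D) j a + ω.1 j a

/-- The noisy histogram of the pair of attributes `p`. -/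
def noisyTwo {m n : ℕ} {s : Fin m → ℕ} {U : Fin m → Type*} (bin : ∀ j, U j → Fin (s j))
    (p : AttrPair m) (D : Fin n → ∀ j, U j) (ω : OneWay s × TwoWay s) :
    Fin (s p.1.1) × Fin (s p.1.2) → ℝ :=
  fun q => countTwo (dummy bin D) p q + ω.2 p q

/-- All noisy histograms together. -/
def noisyStats {m n : ℕ} {s : Fin m → ℕ} {U : Fin m → Type*} (bin : ∀ j, U j → Fin (s j))
    (D : Fin n → ∀ j, U j) (ω : OneWay s × TwoWay s) : OneWay s × TwoWay s :=
  (fun j => noisyOne bin j D ω, fun p => noisyTwo bin p D ω)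

/-- The noisy count of `X = x`, for the binary column `X` of the value `a`, deduced from the noisy
histogram `h` of the attribute, whose negative entries are set to `0`. -/
noncomputable def binCount {r : ℕ} (h : Fin r → ℝ) (a : Fin r) (x : Bool) : ℝ :=
  ∑ b, if decide (b = a) = x then max (h b) 0 else 0

/-- The noisy marginal `F(0)` of the binary column of the value `a`. -/
noncomputable def margin {r : ℕ} (h : Fin r → ℝ) (a : Fin r) : ℝ :=
  binCount h a false / (binCount h a false + binCount h a true)

/-- The noisy count of `(X, Y) = (x, y)`, for the binary columns `X`, `Y` of the values `a`, `b` of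
two distinct attributes, deduced from the noisy histogram `h` of the pair of attributes. -/
noncomputable def binPairCount {r r' : ℕ} (h : Fin r × Fin r' → ℝ) (a : Fin r) (b : Fin r')
    (x y : Bool) : ℝ :=
  ∑ q, if decide (q.1 = a) = x ∧ decide (q.2 = b) = y then h q else 0

/-- The noisy two-way positive conjunction `E(X Y)`. -/
noncomputable def posConj {r r' : ℕ} (h : Fin r × Fin r' → ℝ) (a : Fin r) (b : Fin r') : ℝ :=
  binPairCount h a b true true / ∑ x : Bool, ∑ y : Bool, binPairCount h a b x y

/-- The noisy marginal `F_c(0)` of the column `c`. -/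
noncomputable def colMargin {m : ℕ} {s : Fin m → ℕ} (σ : OneWay s × TwoWay s) (c : Col s) : ℝ :=
  margin (σ.1 (colInfo c).1) (colInfo c).2

/-- The noisy mean of the column `c`. -/
noncomputable def colMean {m : ℕ} {s : Fin m → ℕ} (σ : OneWay s × TwoWay s) (c : Col s) : ℝ :=
  1 - colMargin σ c

/-- The noisy variance of the column `c`. -/
noncomputable def colVar {m : ℕ} {s : Fin m → ℕ} (σ : OneWay s × TwoWay s) (c : Col s) : ℝ :=
  colMean σ c * (1 - colMean σ c)

/-- The noisy `E(X_c X_c')` for columns `c < c'`; two columns of the same attribute are never both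
`1`, which is a structural zero. -/
noncomputable def colConj {m : ℕ} {s : Fin m → ℕ} (σ : OneWay s × TwoWay s) (c c' : Col s) : ℝ :=
  if h : (colInfo c).1 < (colInfo c').1 then
    posConj (σ.2 ⟨((colInfo c).1, (colInfo c').1), h⟩) (colInfo c).2 (colInfo c').2
  else 0

/-- The noisy Pearson correlation of the columns `c < c'`. -/
noncomputable def colCorr {m : ℕ} {s : Fin m → ℕ} (σ : OneWay s × TwoWay s) (c c' : Col s) : ℝ :=
  (colConj σ c c' - colMean σ c * colMean σ c') / Real.sqrt (colVar σ c * colVar σ c')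

/-! ### Copula construction and sampling -/

/-- The quasi-inverse of the distribution function of a binary variable `X` with `P(X = 0) = a`. -/
noncomputable def quasiInv (a t : ℝ) : Bool := decide (a < t)

/-- The standard normal distribution function. -/
noncomputable def stdNormalCDF (y : ℝ) : ℝ := cdf (gaussianReal 0 1) y

/-- The density of the standard bivariate normal distribution with correlation `ρ`. -/
noncomputable def bivariatePDF (ρ y z : ℝ) : ℝ :=
  1 / (2 * Real.pi * Real.sqrt (1 - ρ ^ 2)) *
    Real.exp (-(y ^ 2 + z ^ 2 - 2 * ρ * y * z) / (2 * (1 - ρ ^ 2)))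

/-- Numerical value of the double integral of `F⁻¹(Φ(y)) G⁻¹(Φ(z))` against the bivariate normal
density of correlation `ρ`, with step `0.01` and limits `-10` and `10`, for the binary marginals with
`F(0) = a` and `G(0) = b`. -/
noncomputable def copulaMoment (a b ρ : ℝ) : ℝ :=
  ∑ u ∈ Finset.range 2000, ∑ v ∈ Finset.range 2000,
    (if quasiInv a (stdNormalCDF (-10 + 0.01 * u)) = true ∧
        quasiInv b (stdNormalCDF (-10 + 0.01 * v)) = true then
      bivariatePDF ρ (-10 + 0.01 * u) (-10 + 0.01 * v) * 0.01 ^ 2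
    else 0)

/-- Bisection search on `[-1, 1]`, with the given number of steps, for a `ρ` with `g ρ = target`,
where `g` is thought of as increasing. -/
noncomputable def bisection (g : ℝ → ℝ) (target : ℝ) (steps : ℕ) : ℝ :=
  let final : ℝ × ℝ := (fun I : ℝ × ℝ =>
    if g ((I.1 + I.2) / 2) < target then ((I.1 + I.2) / 2, I.2)
    else (I.1, (I.1 + I.2) / 2))^[steps] (-1, 1)
  (final.1 + final.2) / 2

/-- The Gaussian correlation `ρ` of the columns `c < c'`. -/
noncomputable def gaussCorr {m : ℕ} {s : Fin m → ℕ} (steps : ℕ) (σ : OneWay s × TwoWay s)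
    (c c' : Col s) : ℝ :=
  bisection (copulaMoment (colMargin σ c) (colMargin σ c'))
    (colCorr σ c c' * Real.sqrt (colVar σ c * colVar σ c') + colMean σ c * colMean σ c') steps

/-- The matrix `P` of Gaussian correlations. -/
noncomputable def gaussCorrMatrix {m : ℕ} {s : Fin m → ℕ} (steps : ℕ) (σ : OneWay s × TwoWay s) :
    Matrix (Col s) (Col s) ℝ :=
  Matrix.of fun c c' =>
    if c = c' then 1 else if c < c' then gaussCorr steps σ c c' else gaussCorr steps σ c' c

open Classical in
/-- Apply `f` to the eigenvalues of a symmetric matrix. -/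
noncomputable def spectralMap {d : ℕ} (f : ℝ → ℝ) (A : Matrix (Fin d) (Fin d) ℝ) :
    Matrix (Fin d) (Fin d) ℝ :=
  if h : A.IsHermitian then h.cfc f else A

/-- Set the diagonal to ones. -/
def unitDiag {d : ℕ} (A : Matrix (Fin d) (Fin d) ℝ) : Matrix (Fin d) (Fin d) ℝ :=
  Matrix.of fun i j => if i = j then 1 else A i j

/-- The nearest correlation matrix algorithm: the alternating projections `R = Y - ΔS`,
`X = R⁺`, `ΔS = X - R`, `Y = unitdiag X`, for `k = 1, …, iters - 1`. -/
noncomputable def ncm {d : ℕ} (iters : ℕ) (A : Matrix (Fin d) (Fin d) ℝ) :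
    Matrix (Fin d) (Fin d) ℝ :=
  ((fun st : Matrix (Fin d) (Fin d) ℝ × Matrix (Fin d) (Fin d) ℝ =>
    let R := st.1 - st.2
    let X := spectralMap (fun x => max x 0) R
    (unitDiag X, X - R))^[iters - 1] (A, 0)).1

/-- `L` is a Cholesky factor of `A`: lower triangular with positive diagonal and `Lᵀ L = A`. -/
def IsCholesky {d : ℕ} (A L : Matrix (Fin d) (Fin d) ℝ) : Prop :=
  (∀ i j, i < j → L i j = 0) ∧ (∀ i, 0 < L i i) ∧ L.transpose * L = A

open Classical in
/-- The Cholesky factor (of a positive definite matrix). -/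
noncomputable def chol {d : ℕ} (A : Matrix (Fin d) (Fin d) ℝ) : Matrix (Fin d) (Fin d) ℝ :=
  if h : ∃ L, IsCholesky A L then h.choose else 0

/-- The numerical parameters which the construction leaves open: the number of bisection steps, the
number of iterations of the nearest correlation matrix algorithm, and the small positive value that
replaces vanishing (or negative) eigenvalues. -/
structure Tuning where
  steps : ℕ
  iters : ℕ
  tau : ℝ
  tau_pos : 0 < tau

/-- The copula construction and the sampling of the synthetic binary dataset with `n` rows, as a
function of the noisy statistics `σ` and of standard normal variables `Z`. -/
noncomputable def synthesize {m : ℕ} {s : Fin m → ℕ} (n : ℕ) (t : Tuning)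
    (σ : OneWay s × TwoWay s) (Z : Fin n → Col s → ℝ) : Fin n → Col s → Bool :=
  let P' := spectralMap (fun x => if x ≤ 0 then t.tau else x)
    (ncm t.iters (gaussCorrMatrix t.steps σ))
  let Y := Matrix.of Z * chol P'
  fun k c => quasiInv (colMargin σ c) (stdNormalCDF (Y k c))

/-- The law of the `n × d` matrix of independent standard normal variables. -/
noncomputable def gaussianNoise {m : ℕ} (n : ℕ) (s : Fin m → ℕ) : Measure (Fin n → Col s → ℝ) :=
  Measure.pi fun _ => Measure.pi fun _ => gaussianReal 0 1

/-- The full mechanism, as a function of the database and of its coins, which are the Laplace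
variables and the normal variables. -/
noncomputable def fullMechanism {m n : ℕ} {s : Fin m → ℕ} {U : Fin m → Type*}
    (bin : ∀ j, U j → Fin (s j)) (t : Tuning) (D : Fin n → ∀ j, U j)
    (ω : (OneWay s × TwoWay s) × (Fin n → Col s → ℝ)) : Fin n → Col s → Bool :=
  synthesize n t (noisyStats bin D ω.1) ω.2

end CopulaDP

namespace CopulaDP

/-! ### The budget of advanced composition -/

/-! The privacy loss of independent Laplace histograms is additive: the law of the release on `D'`
has density `exp (-∑ i, L i)` with respect to its law on `D`, where `L i` is the loss of the `i`-th
histogram. Changing one row moves one unit between two bins, so each histogram changes by at most 2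
in the L¹ norm, and with scale `2 / ε'` this gives `|L i| ≤ ε'`. For a single histogram that is pure
privacy.

For the joint release, `exp (-L i)` has mean 1, which forces the mean of `L i` to be at most `ε'
(exp ε' - 1)`. Hoeffding's inequality then bounds by `δ` the probability that the total loss exceeds
`advEps`, and off that event the densities differ by a factor of at most `exp (advEps ..)`
(`advanced_composition`). Margins, conjunctions and the copula sampler only post-process the noisy
histograms (`IsDP.postprocess`, `IsDP.randomized_postprocess`).

Events are arbitrary sets: measurable hulls and measurable equivalences replace measurability
assumptions. -/

theorem log_one_div_pos {δ : ℝ} (hδ : 0 < δ) (hδ1 : δ < 1) : 0 < Real.log (1 / δ) :=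
  Real.log_pos (by rw [lt_div_iff₀ hδ]; simpa using hδ1)

theorem advEps_strictMonoOn (k : ℕ) (hk : 1 ≤ k) {δ : ℝ} (hδ : 0 < δ) (hδ1 : δ < 1) :
    StrictMonoOn (advEps k δ) (Set.Ici 0) := by
  intro x hx y hy hxy
  have hl := log_one_div_pos hδ hδ1
  have hk' : (0 : ℝ) < k := by exact_mod_cast hk
  have h1 : Real.sqrt (2 * k * Real.log (1 / δ)) * x < Real.sqrt (2 * k * Real.log (1 / δ)) * y :=
    mul_lt_mul_of_pos_left hxy (Real.sqrt_pos.2 (by positivity))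
  have hx' : 0 ≤ Real.exp x - 1 := sub_nonneg.2 (Real.one_le_exp hx)
  have h2 : k * x * (Real.exp x - 1) ≤ k * y * (Real.exp y - 1) :=
    mul_le_mul (mul_le_mul_of_nonneg_left hxy.le hk'.le)
      (sub_le_sub_right (Real.exp_le_exp.2 hxy.le) 1) hx' (mul_nonneg hk'.le hy)
  exact add_lt_add_of_lt_of_le h1 h2

theorem continuous_advEps (k : ℕ) (δ : ℝ) : Continuous (advEps k δ) := by
  unfold advEps
  fun_prop

theorem existsUnique_advEps_eq (k : ℕ) (hk : 1 ≤ k) {ε δ : ℝ} (hε : 0 < ε) (hδ : 0 < δ)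
    (hδ1 : δ < 1) : ∃! ε' : ℝ, 0 < ε' ∧ advEps k δ ε' = ε := by
  have hl := log_one_div_pos hδ hδ1
  have hk' : (0 : ℝ) < k := by exact_mod_cast hk
  have ha : 0 < Real.sqrt (2 * k * Real.log (1 / δ)) := Real.sqrt_pos.2 (by positivity)
  set a := Real.sqrt (2 * k * Real.log (1 / δ)) with ha_def
  have hx : 0 < ε / a := by positivity
  -- At `ε / a` the linear term alone already equals `ε`, so this point closes the interval for the
  -- intermediate value theorem.
  have hle : ε ≤ advEps k δ (ε / a) := by
    have h1 : a * (ε / a) = ε := by field_simp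
    have h2 : 0 ≤ k * (ε / a) * (Real.exp (ε / a) - 1) :=
      mul_nonneg (by positivity) (sub_nonneg.2 (Real.one_le_exp hx.le))
    unfold advEps
    rw [← ha_def, h1]
    linarith
  have h0 : advEps k δ 0 = 0 := by simp [advEps]
  obtain ⟨x, hx1, hx2⟩ := intermediate_value_Icc hx.le (continuous_advEps k δ).continuousOn
    (show ε ∈ Set.Icc (advEps k δ 0) (advEps k δ (ε / a)) from ⟨by rw [h0]; exact hε.le, hle⟩)
  have hx0 : 0 < x := lt_of_le_of_ne hx1.1 fun h => by
    rw [← h, h0] at hx2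
    exact hε.ne hx2
  refine ⟨x, ⟨hx0, hx2⟩, fun y hy => ?_⟩
  exact (advEps_strictMonoOn k hk hδ hδ1).injOn hy.1.le hx0.le (hy.2.trans hx2.symm)

/-- In the variable `y = √k ε'` the linear term is `a y` with `a` independent of `k`, so `y ≤ ε /
a`. The other term is at most `y² exp (ε / a)`, hence at most a constant times `y`, and this bounds
`y` from below. -/
theorem exists_bounds_of_advEps_eq {ε δ : ℝ} (hε : 0 < ε) (hδ : 0 < δ) (hδ1 : δ < 1) :
    ∃ c₁ c₂ : ℝ, 0 < c₁ ∧ 0 < c₂ ∧ ∀ k : ℕ, 1 ≤ k → ∀ ε' : ℝ, 0 < ε' → advEps k δ ε' = ε →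
      c₁ / Real.sqrt k ≤ ε' ∧ ε' ≤ c₂ / Real.sqrt k := by
  have hl := log_one_div_pos hδ hδ1
  have ha : 0 < Real.sqrt (2 * Real.log (1 / δ)) := Real.sqrt_pos.2 (by positivity)
  set a := Real.sqrt (2 * Real.log (1 / δ)) with ha_def
  refine ⟨ε / (a + ε / a * Real.exp (ε / a)), ε / a, by positivity, by positivity, ?_⟩
  intro k hk x hx h
  have hk' : (1 : ℝ) ≤ k := by exact_mod_cast hk
  have hr : 1 ≤ Real.sqrt k := Real.one_le_sqrt.2 hk'
  have hrr : Real.sqrt k * Real.sqrt k = k := Real.mul_self_sqrt (by positivity)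
  set r := Real.sqrt k with hr_def
  have hsq : Real.sqrt (2 * k * Real.log (1 / δ)) = a * r := by
    rw [show 2 * (k : ℝ) * Real.log (1 / δ) = 2 * Real.log (1 / δ) * k by ring,
      Real.sqrt_mul (by positivity)]
  unfold advEps at h
  rw [hsq] at h
  have h0 : 0 ≤ k * x * (Real.exp x - 1) :=
    mul_nonneg (by positivity) (sub_nonneg.2 (Real.one_le_exp hx.le))
  have hup : r * x ≤ ε / a := by
    rw [le_div_iff₀ ha]
    nlinarith
  -- From `k ≥ 1`: this bounds `x` itself by `ε / a`, so that `exp x` is bounded uniformly in `k`.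
  have hxr : x ≤ r * x := le_mul_of_one_le_left hx.le hr
  constructor
  · rw [div_le_iff₀ (by positivity), div_le_iff₀ (by positivity)]
    have h1 : Real.exp x - 1 ≤ x * Real.exp (ε / a) := by
      have h2 : Real.exp x - 1 ≤ x * Real.exp x := by
        have h3 := Real.add_one_le_exp (-x)
        have h4 : Real.exp x * Real.exp (-x) = 1 := by rw [← Real.exp_add]; simp
        nlinarith [Real.exp_pos x]
      exact h2.trans (mul_le_mul_of_nonneg_left (Real.exp_le_exp.2 (hxr.trans hup)) hx.le)
    have h5 : k * x * (Real.exp x - 1) ≤ (r * x) * (ε / a * Real.exp (ε / a)) := by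
      calc k * x * (Real.exp x - 1) ≤ k * x * (x * Real.exp (ε / a)) :=
            mul_le_mul_of_nonneg_left h1 (by positivity)
        _ = (r * x) * ((r * x) * Real.exp (ε / a)) := by rw [← hrr]; ring
        _ ≤ _ := by gcongr
    nlinarith
  · rw [le_div_iff₀ (by positivity)]
    linarith

/-! ### Measures of arbitrary sets, and products of densities -/

/-- Passing to the measurable hull with respect to `ν` can only increase the `μ`-measure and keeps
the `ν`-measure. -/
theorem measure_le_mul_add_of_measurableSet {X : Type*} [MeasurableSpace X] {μ ν : Measure X}
    {a b : ℝ≥0∞} (h : ∀ S, MeasurableSet S → μ S ≤ a * ν S + b) (S : Set X) :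
    μ S ≤ a * ν S + b :=
  calc μ S ≤ μ (toMeasurable ν S) := measure_mono (subset_toMeasurable ν S)
    _ ≤ a * ν (toMeasurable ν S) + b := h _ (measurableSet_toMeasurable ν S)
    _ = a * ν S + b := by rw [measure_toMeasurable]

/-- The inequality holds on each slice with the coins fixed. Integrating over the coins preserves
it, and `b` is unchanged because `Q` has mass 1. -/
theorem prod_measure_le_mul_add {X Y : Type*} [MeasurableSpace X] [MeasurableSpace Y]
    {μ ν : Measure X} [SFinite μ] [SFinite ν] (Q : Measure Y) [IsProbabilityMeasure Q]
    {a b : ℝ≥0∞} (h : ∀ S, μ S ≤ a * ν S + b) (S : Set (X × Y)) :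
    μ.prod Q S ≤ a * ν.prod Q S + b := by
  refine measure_le_mul_add_of_measurableSet (fun T hT => ?_) S
  rw [Measure.prod_apply_symm hT, Measure.prod_apply_symm hT]
  calc ∫⁻ y, μ ((fun x => (x, y)) ⁻¹' T) ∂Q
      ≤ ∫⁻ y, (a * ν ((fun x => (x, y)) ⁻¹' T) + b) ∂Q := lintegral_mono fun y => h _
    _ = a * ∫⁻ y, ν ((fun x => (x, y)) ⁻¹' T) ∂Q + b := by
      rw [lintegral_add_right _ measurable_const,
        lintegral_const_mul _ (measurable_measure_prodMk_right hT)]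
      simp

/-- On a box, the density cut off by the indicator is a product of functions of single coordinates,
which are independent under the product measure. -/
theorem pi_withDensity {ι : Type*} [Fintype ι] {X : ι → Type*} [∀ i, MeasurableSpace (X i)]
    (μ : ∀ i, Measure (X i)) [∀ i, IsProbabilityMeasure (μ i)] {f : ∀ i, X i → ℝ≥0∞}
    (hf : ∀ i, Measurable (f i)) [∀ i, SigmaFinite ((μ i).withDensity (f i))] :
    Measure.pi (fun i => (μ i).withDensity (f i)) =
      (Measure.pi μ).withDensity fun x => ∏ i, f i (x i) := by
  refine Measure.pi_eq fun B hB => ?_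
  have hg : ∀ i, Measurable ((B i).indicator (f i)) := fun i => (hf i).indicator (hB i)
  rw [withDensity_apply _ (MeasurableSet.univ_pi hB),
    ← lintegral_indicator (MeasurableSet.univ_pi hB)]
  have h1 : ∀ x : ∀ i, X i, (Set.univ.pi B).indicator (fun x => ∏ i, f i (x i)) x =
      ∏ i, (B i).indicator (f i) (x i) := by
    intro x
    by_cases hx : x ∈ Set.univ.pi B
    · rw [Set.indicator_of_mem hx]
      exact Finset.prod_congr rfl fun i _ => (Set.indicator_of_mem (hx i trivial) _).symm
    · rw [Set.indicator_of_notMem hx]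
      simp only [Set.mem_pi, Set.mem_univ, forall_const, not_forall] at hx
      obtain ⟨i, hi⟩ := hx
      exact (Finset.prod_eq_zero (Finset.mem_univ i) (Set.indicator_of_notMem hi _)).symm
  have hind : iIndepFun (fun i (x : ∀ i, X i) => (B i).indicator (f i) (x i)) (Measure.pi μ) :=
    iIndepFun_pi fun i => (hg i).aemeasurable
  rw [lintegral_congr h1, lintegral_prod_eq_prod_lintegral_of_indepFun _ _ hind
    fun i => (hg i).comp (measurable_pi_apply i)]
  refine Finset.prod_congr rfl fun i _ => ?_
  rw [(measurePreserving_eval μ i).lintegral_comp (hg i), lintegral_indicator (hB i),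
    withDensity_apply _ (hB i)]

/-! ### Advanced composition -/

/-- The left side is at most `x (1 - exp (-x))`, by `1 + x ≤ exp x`. This equals `|x| (exp |x| - 1)`
for `x ≤ 0` and is below it for `x ≥ 0`. -/
theorem add_exp_neg_sub_one_le {e x : ℝ} (hx : |x| ≤ e) :
    x + Real.exp (-x) - 1 ≤ e * (Real.exp e - 1) := by
  have he : 0 ≤ e := (abs_nonneg x).trans hx
  have hmono : |x| * (Real.exp |x| - 1) ≤ e * (Real.exp e - 1) :=
    mul_le_mul hx (sub_le_sub_right (Real.exp_le_exp.2 hx) 1)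
      (sub_nonneg.2 (Real.one_le_exp (abs_nonneg x))) he
  have h4 : Real.exp x * Real.exp (-x) = 1 := by rw [← Real.exp_add]; simp
  have h1 := Real.add_one_le_exp x
  have hp := Real.exp_pos (-x)
  have hkey : x + Real.exp (-x) - 1 ≤ x * (1 - Real.exp (-x)) := by nlinarith
  refine hkey.trans (le_trans ?_ hmono)
  rcases le_total 0 x with h | h
  · rw [abs_of_nonneg h]
    refine mul_le_mul_of_nonneg_left ?_ h
    have h3 := Real.add_one_le_exp (-x)
    linarith
  · rw [abs_of_nonpos h]
    linarith

/-- The mean privacy loss of a pure mechanism. -/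
theorem integral_privacyLoss_le {X : Type*} [MeasurableSpace X] {μ : Measure X}
    [IsProbabilityMeasure μ] {L : X → ℝ} (hL : Measurable L) {e : ℝ} (hb : ∀ x, |L x| ≤ e)
    (h1 : ∫ x, Real.exp (-L x) ∂μ = 1) : ∫ x, L x ∂μ ≤ e * (Real.exp e - 1) := by
  have hi : Integrable L μ := Integrable.of_mem_Icc (-e) e hL.aemeasurable
    (Filter.Eventually.of_forall fun x => abs_le.1 (hb x))
  have hi' : Integrable (fun x => Real.exp (-L x)) μ := by
    refine Integrable.of_mem_Icc 0 (Real.exp e) (by fun_prop)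
      (Filter.Eventually.of_forall fun x => ⟨(Real.exp_pos _).le, Real.exp_le_exp.2 ?_⟩)
    linarith [(abs_le.1 (hb x)).1]
  -- Since `exp (-L)` has mean 1, adding `exp (-L) - 1` does not change the mean of `L`.
  have h2 : ∫ x, (L x + Real.exp (-L x) - 1) ∂μ ≤ ∫ _, e * (Real.exp e - 1) ∂μ :=
    integral_mono ((hi.add hi').sub (integrable_const 1)) (integrable_const _)
      fun x => add_exp_neg_sub_one_le (hb x)
  have hadd : Integrable (fun x => L x + Real.exp (-L x)) μ := hi.add hi'
  rw [integral_sub hadd (integrable_const 1), integral_add hi hi', h1] at h2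
  simpa using h2

/-- The two summands of `advEps` are the Hoeffding deviation `t` and the bound on the mean of the
total loss. -/
theorem measure_sum_privacyLoss_gt_le {ι : Type*} [Fintype ι] [Nonempty ι] {X : ι → Type*}
    [∀ i, MeasurableSpace (X i)] (μ : ∀ i, Measure (X i)) [∀ i, IsProbabilityMeasure (μ i)]
    {L : ∀ i, X i → ℝ} (hL : ∀ i, Measurable (L i)) {e δ : ℝ} (he : 0 < e) (hδ : 0 < δ)
    (hδ1 : δ < 1) (hb : ∀ i x, |L i x| ≤ e) (h1 : ∀ i, ∫ x, Real.exp (-L i x) ∂μ i = 1) :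
    Measure.pi μ {x | advEps (Fintype.card ι) δ e < ∑ i, L i (x i)} ≤ ENNReal.ofReal δ := by
  have hl := log_one_div_pos hδ hδ1
  set k := Fintype.card ι with hk
  have hk0 : (0 : ℝ) < k := by exact_mod_cast Fintype.card_pos (α := ι)
  set t := Real.sqrt (2 * k * Real.log (1 / δ)) * e with ht
  have ht0 : 0 ≤ t := by positivity
  have hsub : ∀ i ∈ Finset.univ, HasSubgaussianMGF (fun x : ∀ i, X i => L i (x i) - ∫ x, L i x ∂μ i)
      ((‖e - -e‖₊ / 2) ^ 2) (Measure.pi μ) := by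
    intro i _
    have h := hasSubgaussianMGF_of_mem_Icc (μ := Measure.pi μ) (X := fun x => L i (x i))
      (a := -e) (b := e) ((hL i).comp (measurable_pi_apply i)).aemeasurable
      (Filter.Eventually.of_forall fun x => abs_le.1 (hb i (x i)))
    have hmap := integral_map (measurePreserving_eval μ i).aemeasurable
      (hL i).aestronglyMeasurable
    rw [(measurePreserving_eval μ i).map_eq] at hmap
    rw [hmap]
    exact h
  have hind : iIndepFun (fun i (x : ∀ i, X i) => L i (x i) - ∫ x, L i x ∂μ i) (Measure.pi μ) :=
    iIndepFun_pi (X := fun i y => L i y - ∫ x, L i x ∂μ i)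
      fun i => ((hL i).sub_const _).aemeasurable
  have hH := HasSubgaussianMGF.measure_sum_ge_le_of_iIndepFun hind hsub ht0
  -- The deviation `t` is the one for which Hoeffding's bound `exp (-t² / (2 k e²))` is exactly `δ`.
  have hval : Real.exp (-t ^ 2 / (2 * ((∑ i : ι, (‖e - -e‖₊ / 2) ^ 2 : NNReal) : ℝ))) = δ := by
    have hn : ‖e - -e‖ = 2 * e := by
      rw [Real.norm_eq_abs, abs_of_nonneg (by linarith)]
      ring
    have hs : ((∑ i : ι, (‖e - -e‖₊ / 2) ^ 2 : NNReal) : ℝ) = k * e ^ 2 := by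
      push_cast
      rw [hn]
      simp [hk]
    have ht2 : t ^ 2 = 2 * k * Real.log (1 / δ) * e ^ 2 := by
      rw [ht, mul_pow, Real.sq_sqrt (by positivity)]
    rw [hs, ht2, show -(2 * k * Real.log (1 / δ) * e ^ 2) / (2 * (k * e ^ 2)) = -Real.log (1 / δ) by
      field_simp, Real.exp_neg, Real.exp_log (by positivity)]
    simp
  have hsubset : {x : ∀ i, X i | advEps k δ e < ∑ i, L i (x i)} ⊆
      {x | t ≤ ∑ i, (L i (x i) - ∫ x, L i x ∂μ i)} := by
    intro x hx
    simp only [Set.mem_ofPred_eq, advEps] at hx ⊢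
    have hm : ∑ i, ∫ x, L i x ∂μ i ≤ k * (e * (Real.exp e - 1)) :=
      (Finset.sum_le_sum fun i _ => integral_privacyLoss_le (hL i) (hb i) (h1 i)).trans
        (by simp [hk])
    rw [Finset.sum_sub_distrib]
    rw [← ht] at hx
    linarith
  refine (measure_mono hsubset).trans ?_
  rw [← ofReal_measureReal]
  refine ENNReal.ofReal_le_ofReal ?_
  rw [← hval]
  exact hH

theorem measure_le_exp_mul_withDensity {X : Type*} [MeasurableSpace X] {μ : Measure X}
    {L : X → ℝ} (hL : Measurable L) {ε : ℝ} {S : Set X} (hS : MeasurableSet S)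
    (h : ∀ x ∈ S, L x ≤ ε) :
    μ S ≤ ENNReal.ofReal (Real.exp ε) *
      μ.withDensity (fun x => ENNReal.ofReal (Real.exp (-L x))) S := by
  rw [withDensity_apply _ hS, ← lintegral_const_mul _ (by fun_prop), ← setLIntegral_one]
  refine setLIntegral_mono' hS fun x hx => ?_
  rw [← ENNReal.ofReal_mul (Real.exp_pos _).le, ← Real.exp_add, ENNReal.one_le_ofReal]
  exact Real.one_le_exp (by linarith [h x hx])

/-- Advanced composition of the non-adaptive release of independent pure mechanisms, of which
`L i` are the privacy losses. -/
theorem advanced_composition {ι : Type*} [Fintype ι] [Nonempty ι] {X : ι → Type*}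
    [∀ i, MeasurableSpace (X i)] (μ : ∀ i, Measure (X i)) [∀ i, IsProbabilityMeasure (μ i)]
    {L : ∀ i, X i → ℝ} (hL : ∀ i, Measurable (L i)) {e δ : ℝ} (he : 0 < e) (hδ : 0 < δ)
    (hδ1 : δ < 1) (hb : ∀ i x, |L i x| ≤ e) (h1 : ∀ i, ∫ x, Real.exp (-L i x) ∂μ i = 1)
    (S : Set (∀ i, X i)) :
    Measure.pi μ S ≤ ENNReal.ofReal (Real.exp (advEps (Fintype.card ι) δ e)) *
      (Measure.pi μ).withDensity (fun x => ENNReal.ofReal (Real.exp (-∑ i, L i (x i)))) S +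
      ENNReal.ofReal δ := by
  refine measure_le_mul_add_of_measurableSet (fun T hT => ?_) S
  have hm : Measurable fun x : ∀ i, X i => ∑ i, L i (x i) :=
    Finset.measurable_sum _ fun i _ => (hL i).comp (measurable_pi_apply i)
  -- On `G` the loss is within budget, so the densities compare pointwise; the complement of `G`
  -- costs at most `δ`.
  set G := {x : ∀ i, X i | ∑ i, L i (x i) ≤ advEps (Fintype.card ι) δ e}
  have hG : MeasurableSet G := measurableSet_le hm measurable_const
  rw [← measure_inter_add_sdiff T hG]
  refine add_le_add ?_ ?_
  · refine (measure_le_exp_mul_withDensity hm (hT.inter hG) fun x hx => hx.2).trans ?_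
    gcongr
    exact Set.inter_subset_left
  · refine (measure_mono fun x hx => ?_).trans
      (measure_sum_privacyLoss_gt_le μ hL he hδ hδ1 hb h1)
    simpa [G] using hx.2

/-! ### The Laplace mechanism -/

theorem integral_laplace_density {b : ℝ} (hb : 0 < b) :
    ∫ x : ℝ, 1 / (2 * b) * Real.exp (-|x| / b) = 1 := by
  rw [integral_const_mul, integral_comp_abs (f := fun x => Real.exp (-x / b))]
  have h := integral_exp_mul_Ioi (a := -b⁻¹) (by simpa using hb) 0
  have h2 : ∀ x : ℝ, Real.exp (-x / b) = Real.exp (-b⁻¹ * x) := fun x => by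
    congr 1
    ring
  simp_rw [h2, h]
  simp only [mul_zero, Real.exp_zero]
  field_simp

theorem isProbabilityMeasure_laplace {b : ℝ} (hb : 0 < b) :
    IsProbabilityMeasure (laplace b) := by
  have h := integral_laplace_density hb
  constructor
  rw [laplace, withDensity_apply _ MeasurableSet.univ, Measure.restrict_univ,
    ← ofReal_integral_eq_lintegral_ofReal (integrable_of_integral_eq_one h)
      (Filter.Eventually.of_forall fun x => by positivity), h, ENNReal.ofReal_one]

theorem laplace_map_add (b c : ℝ) :
    (laplace b).map (· + c) =
      volume.withDensity fun x => ENNReal.ofReal (1 / (2 * b) * Real.exp (-|x - c| / b)) := by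
  ext S hS
  rw [Measure.map_apply (measurable_add_const c) hS, laplace,
    withDensity_apply _ (measurable_add_const c hS), withDensity_apply _ hS,
    ← (measurePreserving_add_right volume c).setLIntegral_comp_preimage hS (by fun_prop)]
  simp

theorem laplace_map_add_eq_withDensity (b c c' : ℝ) :
    (laplace b).map (· + c') = ((laplace b).map (· + c)).withDensity fun x =>
      ENNReal.ofReal (Real.exp (-((|x - c'| - |x - c|) / b))) := by
  rw [laplace_map_add, laplace_map_add, ← withDensity_mul _ (by fun_prop) (by fun_prop)]
  congr 1
  ext x
  rw [Pi.mul_apply, ← ENNReal.ofReal_mul' (Real.exp_pos _).le, mul_assoc, ← Real.exp_add]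
  congr 3
  ring

/-- The privacy loss, at the output `x`, of the Laplace mechanism of scale `b` with the exact
answers `u` and `u'` on the two databases. -/
noncomputable def laplaceLoss {K : Type*} [Fintype K] (b : ℝ) (u u' x : K → ℝ) : ℝ :=
  (∑ a, (|x a - u' a| - |x a - u a|)) / b

theorem measurable_laplaceLoss {K : Type*} [Fintype K] (b : ℝ) (u u' : K → ℝ) :
    Measurable (laplaceLoss b u u') := by
  unfold laplaceLoss
  fun_prop

/-- The reverse triangle inequality in each bin; the loss is bounded by L¹-sensitivity over scale.
-/
theorem abs_laplaceLoss_le {K : Type*} [Fintype K] {b : ℝ} (hb : 0 < b) (u u' x : K → ℝ) :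
    |laplaceLoss b u u' x| ≤ (∑ a, |u a - u' a|) / b := by
  rw [laplaceLoss, abs_div, abs_of_pos hb]
  refine div_le_div_of_nonneg_right ?_ hb.le
  refine (Finset.abs_sum_le_sum_abs _ _).trans (Finset.sum_le_sum fun a _ => ?_)
  refine (abs_abs_sub_abs_le _ _).trans_eq ?_
  congr 1
  ring

/-! ### The Laplace mechanism on one histogram -/

section Blocks

variable {K : Type*} [Fintype K] {b : ℝ}

/-- The law of the Laplace mechanism with the exact answers `u`. -/
noncomputable def laplaceMech (b : ℝ) (u : K → ℝ) : Measure (K → ℝ) :=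
  Measure.pi fun a => (laplace b).map (· + u a)

theorem isProbabilityMeasure_laplaceMech (hb : 0 < b) (u : K → ℝ) :
    IsProbabilityMeasure (laplaceMech b u) := by
  have := isProbabilityMeasure_laplace hb
  have : ∀ a, IsProbabilityMeasure ((laplace b).map (· + u a)) := fun a =>
    Measure.isProbabilityMeasure_map (measurable_add_const _).aemeasurable
  unfold laplaceMech
  infer_instance

theorem map_add_laplace_pi (hb : 0 < b) (u : K → ℝ) :
    (Measure.pi fun _ : K => laplace b).map (· + u) = laplaceMech b u := by
  have := isProbabilityMeasure_laplace hb
  have : ∀ a, IsProbabilityMeasure ((laplace b).map (· + u a)) := fun a =>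
    Measure.isProbabilityMeasure_map (measurable_add_const _).aemeasurable
  exact Measure.pi_map_pi (f := fun a (x : ℝ) => x + u a)
    fun a => (measurable_add_const _).aemeasurable

theorem laplaceMech_eq_withDensity (hb : 0 < b) (u u' : K → ℝ) :
    laplaceMech b u' = (laplaceMech b u).withDensity fun x =>
      ENNReal.ofReal (Real.exp (-laplaceLoss b u u' x)) := by
  have := isProbabilityMeasure_laplace hb
  have h : ∀ (v : K → ℝ) a, IsProbabilityMeasure ((laplace b).map (· + v a)) := fun v a =>
    Measure.isProbabilityMeasure_map (measurable_add_const _).aemeasurable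
  have := h u
  -- Each factor with density is again a shifted Laplace law; this supplies the σ-finiteness that
  -- `pi_withDensity` requires.
  have : ∀ a, IsProbabilityMeasure (((laplace b).map (· + u a)).withDensity fun x =>
      ENNReal.ofReal (Real.exp (-((|x - u' a| - |x - u a|) / b)))) := fun a => by
    rw [← laplace_map_add_eq_withDensity]
    exact h u' a
  unfold laplaceMech
  simp_rw [fun a => laplace_map_add_eq_withDensity b (u a) (u' a)]
  rw [pi_withDensity _ fun a => by fun_prop]
  congr 1
  ext x
  rw [← ENNReal.ofReal_prod_of_nonneg fun a _ => (Real.exp_pos _).le, ← Real.exp_sum,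
    Finset.sum_neg_distrib, laplaceLoss, Finset.sum_div]

/-- The integral is the total mass of the mechanism with the answers `u'`. -/
theorem integral_exp_neg_laplaceLoss (hb : 0 < b) (u u' : K → ℝ) :
    ∫ x, Real.exp (-laplaceLoss b u u' x) ∂laplaceMech b u = 1 := by
  have hm := measurable_laplaceLoss b u u'
  rw [integral_eq_lintegral_of_nonneg_ae
    (Filter.Eventually.of_forall fun x => (Real.exp_pos _).le) (by fun_prop),
    ← setLIntegral_univ, ← withDensity_apply _ MeasurableSet.univ,
    ← laplaceMech_eq_withDensity hb u u']
  have := isProbabilityMeasure_laplaceMech hb u'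
  simp

end Blocks

/-! ### Joint release of independent noisy histograms -/

section Family

variable {ι : Type*} [Fintype ι] {K : ι → Type*} [∀ i, Fintype (K i)] {b : ℝ}

/-- The Laplace variables of a family of histograms. -/
noncomputable def laplaceFamily (K : ι → Type*) [∀ i, Fintype (K i)] (b : ℝ) :
    Measure (∀ i, K i → ℝ) :=
  Measure.pi fun i => Measure.pi fun _ : K i => laplace b

theorem map_add_laplaceFamily (hb : 0 < b) (u : ∀ i, K i → ℝ) :
    (laplaceFamily K b).map (· + u) = Measure.pi fun i => laplaceMech b (u i) := by
  have := isProbabilityMeasure_laplace hb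
  have : ∀ i, IsProbabilityMeasure ((Measure.pi fun _ : K i => laplace b).map (· + u i)) := fun i =>
    Measure.isProbabilityMeasure_map (measurable_add_const _).aemeasurable
  simp_rw [← map_add_laplace_pi hb]
  exact Measure.pi_map_pi (f := fun i (x : K i → ℝ) => x + u i)
    fun i => (measurable_add_const _).aemeasurable

theorem pi_laplaceMech_eq_withDensity (hb : 0 < b) (u u' : ∀ i, K i → ℝ) :
    (Measure.pi fun i => laplaceMech b (u' i)) =
      (Measure.pi fun i => laplaceMech b (u i)).withDensity fun x =>
        ENNReal.ofReal (Real.exp (-∑ i, laplaceLoss b (u i) (u' i) (x i))) := by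
  have hp := fun i => isProbabilityMeasure_laplaceMech hb (u i)
  have hp' := fun i => isProbabilityMeasure_laplaceMech hb (u' i)
  simp_rw [fun i => laplaceMech_eq_withDensity hb (u i) (u' i)] at hp' ⊢
  rw [pi_withDensity _ fun i => by
    have := measurable_laplaceLoss b (u i) (u' i)
    fun_prop]
  congr 1
  ext x
  rw [← ENNReal.ofReal_prod_of_nonneg fun a _ => (Real.exp_pos _).le, ← Real.exp_sum,
    Finset.sum_neg_distrib]

/-- The joint release of histograms, each of sensitivity `2`. -/
theorem laplaceFamily_map_add_le [Nonempty ι] {e δ : ℝ} (he : 0 < e) (hδ : 0 < δ) (hδ1 : δ < 1)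
    {u u' : ∀ i, K i → ℝ} (hu : ∀ i, ∑ a, |u i a - u' i a| ≤ 2) (S : Set (∀ i, K i → ℝ)) :
    (laplaceFamily K (2 / e)).map (· + u) S ≤
      ENNReal.ofReal (Real.exp (advEps (Fintype.card ι) δ e)) *
        (laplaceFamily K (2 / e)).map (· + u') S + ENNReal.ofReal δ := by
  have hb : 0 < 2 / e := by positivity
  have := fun i => isProbabilityMeasure_laplaceMech hb (u i)
  rw [map_add_laplaceFamily hb, map_add_laplaceFamily hb, pi_laplaceMech_eq_withDensity hb u u']
  refine advanced_composition _ (fun i => measurable_laplaceLoss _ _ _) he hδ hδ1 (fun i x => ?_)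
    (fun i => integral_exp_neg_laplaceLoss hb _ _) S
  refine (abs_laplaceLoss_le hb _ _ _).trans ?_
  rw [div_le_iff₀ hb]
  exact (hu i).trans_eq (by field_simp)

/-- The release of a single histogram of sensitivity `2`. -/
theorem laplaceFamily_map_add_le_of_forall_ne {e : ℝ} (he : 0 < e) {u u' : ∀ i, K i → ℝ} (j : ι)
    (hu : ∑ a, |u j a - u' j a| ≤ 2) (hne : ∀ i, i ≠ j → u i = u' i) (S : Set (∀ i, K i → ℝ)) :
    (laplaceFamily K (2 / e)).map (· + u) S ≤
      ENNReal.ofReal (Real.exp e) * (laplaceFamily K (2 / e)).map (· + u') S := by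
  have hb : 0 < 2 / e := by positivity
  have hm : Measurable fun x : ∀ i, K i → ℝ => ∑ i, laplaceLoss (2 / e) (u i) (u' i) (x i) :=
    Finset.measurable_sum _ fun i _ => (measurable_laplaceLoss _ _ _).comp (measurable_pi_apply i)
  rw [map_add_laplaceFamily hb, map_add_laplaceFamily hb, pi_laplaceMech_eq_withDensity hb u u']
  refine (measure_le_mul_add_of_measurableSet (b := 0) (fun T hT => ?_) S).trans_eq (add_zero _)
  rw [add_zero]
  refine measure_le_exp_mul_withDensity hm hT fun x _ => ?_
  -- Histograms on which `u` and `u'` agree have zero loss, so the total loss is that of `j`,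
  -- bounded everywhere by `e`; no exceptional event is needed.
  rw [Finset.sum_eq_single j (fun i _ hi => by simp [laplaceLoss, hne i hi])
    fun h => (h (Finset.mem_univ j)).elim]
  refine (le_abs_self _).trans ((abs_laplaceLoss_le hb _ _ _).trans ?_)
  rw [div_le_iff₀ hb]
  exact hu.trans_eq (by field_simp)

end Family

/-! ### Sensitivity of histograms -/

/-- Only row `i` contributes to the difference: it leaves the bin `v (D i)` and enters `v (D' i)`.
-/
theorem Neighbors.sum_abs_card_sub_card_le {X A : Type*} [Fintype A] [DecidableEq A] {n : ℕ}
    {D D' : Fin n → X} (h : Neighbors D D') (v : X → A) :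
    ∑ a, |((Finset.univ.filter fun k => v (D k) = a).card : ℝ) -
      ((Finset.univ.filter fun k => v (D' k) = a).card : ℝ)| ≤ 2 := by
  obtain ⟨i, -, hi⟩ := h
  have hd : ∀ a, ((Finset.univ.filter fun k => v (D k) = a).card : ℝ) -
      ((Finset.univ.filter fun k => v (D' k) = a).card : ℝ) =
      (if v (D i) = a then 1 else 0) - (if v (D' i) = a then 1 else 0) := by
    intro a
    rw [Finset.natCast_card_filter, Finset.natCast_card_filter, ← Finset.sum_sub_distrib]
    exact Finset.sum_eq_single i (fun k _ hk => by rw [hi k hk, sub_self])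
      fun h => (h (Finset.mem_univ i)).elim
  simp_rw [hd]
  calc ∑ a, |(if v (D i) = a then (1 : ℝ) else 0) - (if v (D' i) = a then 1 else 0)|
      ≤ ∑ a, ((if v (D i) = a then (1 : ℝ) else 0) + (if v (D' i) = a then 1 else 0)) :=
        Finset.sum_le_sum fun a _ => by split_ifs <;> simp
    _ = 2 := by
      rw [Finset.sum_add_distrib]
      simp
      norm_num

theorem dummy_colOf {m n : ℕ} {s : Fin m → ℕ} {U : Fin m → Type*} (bin : ∀ j, U j → Fin (s j))
    (D : Fin n → ∀ j, U j) (k : Fin n) (j : Fin m) (a : Fin (s j)) :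
    dummy bin D k (colOf j a) = true ↔ bin j (D k j) = a := by
  have h : colInfo (colOf j a) = ⟨j, a⟩ := finSigmaFinEquiv.symm_apply_apply _
  unfold dummy
  rw [h]
  exact decide_eq_true_iff

theorem card_attrPair (m : ℕ) : Fintype.card (AttrPair m) = m.choose 2 := by
  rw [Fintype.card_subtype]
  have h : (Finset.univ.filter fun p : Fin m × Fin m => p.1 < p.2).card =
      ∑ j : Fin m, (j : ℕ) := by
    rw [Finset.card_filter, ← Finset.univ_product_univ, Finset.sum_product_right]
    refine Finset.sum_congr rfl fun j _ => ?_
    rw [← Finset.card_filter, Finset.filter_gt_eq_Iio, Fin.card_Iio]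
  rw [h, Fin.sum_univ_eq_sum_range (fun j => j), Finset.sum_range_id, Nat.choose_two_right]

/-! ### The noisy histograms as one family -/

section Histograms

variable {m n : ℕ} {s : Fin m → ℕ} {U : Fin m → Type*}

/-- The cells of the histogram of an attribute, or of a pair of attributes. -/
abbrev Cell (s : Fin m → ℕ) : Fin m ⊕ AttrPair m → Type
  | .inl j => Fin (s j)
  | .inr p => Fin (s p.1.1) × Fin (s p.1.2)

instance instFintypeCell (s : Fin m → ℕ) : ∀ i, Fintype (Cell s i)
  | .inl j => inferInstanceAs (Fintype (Fin (s j)))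
  | .inr p => inferInstanceAs (Fintype (Fin (s p.1.1) × Fin (s p.1.2)))

/-- The exact histograms. -/
def exactHist (bin : ∀ j, U j → Fin (s j)) (D : Fin n → ∀ j, U j) : ∀ i, Cell s i → ℝ
  | .inl j => fun a => countOne (dummy bin D) j a
  | .inr p => fun q => countTwo (dummy bin D) p q

/-- In both cases the bins count the values of a public function of a single row, so a row lies in
exactly one bin. -/
theorem sum_abs_exactHist_sub_le (bin : ∀ j, U j → Fin (s j)) {D D' : Fin n → ∀ j, U j}
    (h : Neighbors D D') : ∀ i, ∑ a, |exactHist bin D i a - exactHist bin D' i a| ≤ 2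
  | .inl j => by
    refine le_of_eq_of_le ?_ (h.sum_abs_card_sub_card_le fun r => bin j (r j))
    refine Finset.sum_congr rfl fun a _ => ?_
    simp only [exactHist, countOne, dummy_colOf]
  | .inr p => by
    refine le_of_eq_of_le ?_
      (h.sum_abs_card_sub_card_le fun r => (bin p.1.1 (r p.1.1), bin p.1.2 (r p.1.2)))
    refine Finset.sum_congr rfl fun q _ => ?_
    simp only [exactHist, countTwo, dummy_colOf, Prod.ext_iff]

/-- Histograms indexed by attributes and pairs of attributes, as a pair of families. -/
def splitHist (s : Fin m → ℕ) : (∀ i, Cell s i → ℝ) ≃ᵐ OneWay s × TwoWay s :=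
  MeasurableEquiv.sumPiEquivProdPi fun i => Cell s i → ℝ

theorem measurePreserving_splitHist (s : Fin m → ℕ) {ε' : ℝ} (hε' : 0 < ε') :
    MeasurePreserving (splitHist s) (laplaceFamily (Cell s) (2 / ε')) (noise s ε') := by
  have := isProbabilityMeasure_laplace (show 0 < 2 / ε' by positivity)
  exact measurePreserving_sumPiEquivProdPi fun i => Measure.pi fun _ : Cell s i => laplace (2 / ε')

/-- The release of noisy histograms is a translation of the Laplace variables. -/
theorem noise_add_mem (s : Fin m → ℕ) {ε' : ℝ} (hε' : 0 < ε') (u : ∀ i, Cell s i → ℝ)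
    (S : Set (∀ i, Cell s i → ℝ)) :
    noise s ε' {ω | (splitHist s).symm ω + u ∈ S} =
      (laplaceFamily (Cell s) (2 / ε')).map (· + u) S := by
  -- For a measurable equivalence the image formula holds on all sets, as the arbitrary events of
  -- `IsDP` require.
  have h := MeasurableEquiv.map_apply (MeasurableEquiv.addRight u)
    (μ := laplaceFamily (Cell s) (2 / ε')) S
  rw [MeasurableEquiv.coe_addRight] at h
  rw [h, ← (measurePreserving_splitHist s hε').measure_preimage_equiv]
  congr 1
  ext x
  simp

theorem splitHist_symm_add_exactHist (bin : ∀ j, U j → Fin (s j)) (D : Fin n → ∀ j, U j)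
    (ω : OneWay s × TwoWay s) :
    splitHist s ((splitHist s).symm ω + exactHist bin D) = noisyStats bin D ω := by
  refine Prod.ext ?_ ?_
  · funext j a
    exact add_comm (ω.1 j a) (countOne (dummy bin D) j a : ℝ)
  · funext p q
    exact add_comm (ω.2 p q) (countTwo (dummy bin D) p q : ℝ)

theorem isDP_noisyStats (hm : 1 ≤ m) (bin : ∀ j, U j → Fin (s j)) {δ ε' : ℝ} (hδ : 0 < δ)
    (hδ1 : δ < 1) (hε' : 0 < ε') :
    IsDP (n := n) (noise s ε') (noisyStats bin) (advEps (m + m.choose 2) δ ε') δ := by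
  intro D D' h S
  have : Nonempty (Fin m ⊕ AttrPair m) := ⟨.inl ⟨0, hm⟩⟩
  have hle := laplaceFamily_map_add_le hε' hδ hδ1 (sum_abs_exactHist_sub_le bin h)
    (splitHist s ⁻¹' S)
  rw [← noise_add_mem s hε', ← noise_add_mem s hε', Fintype.card_sum, Fintype.card_fin,
    card_attrPair] at hle
  simpa only [Set.mem_preimage, splitHist_symm_add_exactHist] using hle

/-- The release of the single histogram `i`. -/
theorem isDP_hist (bin : ∀ j, U j → Fin (s j)) {ε' : ℝ} (hε' : 0 < ε') (i : Fin m ⊕ AttrPair m) :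
    IsDP (n := n) (noise s ε')
      (fun D ω => (splitHist s).symm ω i + exactHist bin D i) ε' 0 := by
  classical
  intro D D' h S
  -- The event sees only coordinate `i`, so the other histograms may be replaced by zero; the two
  -- shifts then differ at `i` alone.
  have hle := laplaceFamily_map_add_le_of_forall_ne hε'
    (u := Pi.single i (exactHist bin D i)) (u' := Pi.single i (exactHist bin D' i)) i
    (by simpa using sum_abs_exactHist_sub_le bin h i)
    (fun k hk => by simp [hk]) {x | x i ∈ S}
  rw [← noise_add_mem s hε', ← noise_add_mem s hε'] at hle
  simpa using hle

theorem IsDP.postprocess {X Ω R R' : Type*} [MeasurableSpace Ω] {P : Measure Ω}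
    {M : (Fin n → X) → Ω → R} {ε δ : ℝ} (h : IsDP P M ε δ) (f : R → R') :
    IsDP P (fun D ω => f (M D ω)) ε δ :=
  fun D D' hD S => h D D' hD (f ⁻¹' S)

theorem isDP_noisyOne (bin : ∀ j, U j → Fin (s j)) {ε' : ℝ} (hε' : 0 < ε') (j : Fin m) :
    IsDP (n := n) (noise s ε') (noisyOne bin j) ε' 0 := by
  refine (funext₂ fun D ω => ?_ : _ = noisyOne bin j) ▸ isDP_hist bin hε' (.inl j)
  exact congrFun (congrArg Prod.fst (splitHist_symm_add_exactHist bin D ω)) j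

theorem isDP_noisyTwo (bin : ∀ j, U j → Fin (s j)) {ε' : ℝ} (hε' : 0 < ε') (p : AttrPair m) :
    IsDP (n := n) (noise s ε') (noisyTwo bin p) ε' 0 := by
  refine (funext₂ fun D ω => ?_ : _ = noisyTwo bin p) ▸ isDP_hist bin hε' (.inr p)
  exact congrFun (congrArg Prod.snd (splitHist_symm_add_exactHist bin D ω)) p

theorem isProbabilityMeasure_noise (s : Fin m → ℕ) {ε' : ℝ} (hε' : 0 < ε') :
    IsProbabilityMeasure (noise s ε') := by
  have := isProbabilityMeasure_laplace (show 0 < 2 / ε' by positivity)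
  unfold noise
  infer_instance

/-- The noisy histograms, as a bijection of the Laplace variables. -/
def noisyStatsEquiv (bin : ∀ j, U j → Fin (s j)) (D : Fin n → ∀ j, U j) :
    OneWay s × TwoWay s ≃ᵐ OneWay s × TwoWay s :=
  ((splitHist s).symm.trans (MeasurableEquiv.addRight (exactHist bin D))).trans (splitHist s)

theorem coe_noisyStatsEquiv (bin : ∀ j, U j → Fin (s j)) (D : Fin n → ∀ j, U j) :
    ⇑(noisyStatsEquiv bin D) = noisyStats bin D :=
  funext fun ω => splitHist_symm_add_exactHist bin D ω

/-- Post-processing of the noisy histograms with independent coins; neither the post-processing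
map nor the events need to be measurable. -/
theorem IsDP.randomized_postprocess {bin : ∀ j, U j → Fin (s j)} {P : Measure (OneWay s × TwoWay s)}
    [SFinite P] {ε δ : ℝ} (h : IsDP (n := n) P (noisyStats bin) ε δ) {Ω' R' : Type*}
    [MeasurableSpace Ω'] (Q : Measure Ω') [IsProbabilityMeasure Q]
    (f : OneWay s × TwoWay s → Ω' → R') :
    IsDP (n := n) (P.prod Q) (fun D ω => f (noisyStats bin D ω.1) ω.2) ε δ := by
  intro D D' hD S
  -- `noisyStats bin E` is a bijection of the Laplace variables, so the database can be moved from
  -- the event into the measure even for non-measurable events.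
  have key : ∀ E : Fin n → ∀ j, U j,
      P.prod Q {ω | f (noisyStats bin E ω.1) ω.2 ∈ S} =
        (P.map (noisyStatsEquiv bin E)).prod Q {x | f x.1 x.2 ∈ S} := by
    intro E
    have hmap := Measure.map_prod_map P Q (noisyStatsEquiv bin E).measurable measurable_id
    have happ := MeasurableEquiv.map_apply
      ((noisyStatsEquiv bin E).prodCongr (MeasurableEquiv.refl Ω')) (μ := P.prod Q)
      {x | f x.1 x.2 ∈ S}
    rw [Measure.map_id] at hmap
    rw [hmap]
    refine Eq.trans ?_ happ.symm
    rw [← coe_noisyStatsEquiv]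
    rfl
  rw [key, key]
  refine prod_measure_le_mul_add Q (fun T => ?_) _
  rw [MeasurableEquiv.map_apply, MeasurableEquiv.map_apply, coe_noisyStatsEquiv,
    coe_noisyStatsEquiv]
  exact h D D' hD T

end Histograms

end CopulaDP

open CopulaDP in
theorem mainTheorem3 {m n : ℕ} (hm : 1 ≤ m) (s : Fin m → ℕ) {U : Fin m → Type*}
    (bin : ∀ j, U j → Fin (s j)) (ε δ : ℝ) (hε : 0 < ε) (hδ : 0 < δ) (hδ1 : δ < 1) :
    -- the number of computations, and the budget of each of them
    Fintype.card (Fin m ⊕ AttrPair m) = m + m.choose 2 ∧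
    (∃! ε' : ℝ, 0 < ε' ∧ advEps (m + m.choose 2) δ ε' = ε) ∧
    (∃ c₁ c₂ : ℝ, 0 < c₁ ∧ 0 < c₂ ∧ ∀ k : ℕ, 1 ≤ k → ∀ ε' : ℝ, 0 < ε' → advEps k δ ε' = ε →
      c₁ / Real.sqrt k ≤ ε' ∧ ε' ≤ c₂ / Real.sqrt k) ∧
    ∀ ε' : ℝ, 0 < ε' → advEps (m + m.choose 2) δ ε' = ε →
      -- each computation of one-way margins is `(ε', 0)`-differentially private
      (∀ j : Fin m, IsDP (n := n) (noise s ε') (noisyOne bin j) ε' 0) ∧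
      (∀ j : Fin m, IsDP (n := n) (noise s ε')
        (fun D ω => margin (noisyOne bin j D ω)) ε' 0) ∧
      -- each computation of two-way positive conjunctions is `(ε', 0)`-differentially private
      (∀ p : AttrPair m, IsDP (n := n) (noise s ε') (noisyTwo bin p) ε' 0) ∧
      (∀ p : AttrPair m, IsDP (n := n) (noise s ε')
        (fun D ω => posConj (noisyTwo bin p D ω)) ε' 0) ∧
      -- all of them together, with any randomized post-processing `f`
      IsDP (n := n) (noise s ε') (noisyStats bin) ε δ ∧
      (∀ (Ω' : Type*) (_ : MeasurableSpace Ω') (Q : Measure Ω') (_ : IsProbabilityMeasure Q)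
        (R' : Type*) (f : OneWay s × TwoWay s → Ω' → R'),
        IsDP (n := n) ((noise s ε').prod Q)
          (fun D ω => f (noisyStats bin D ω.1) ω.2) ε δ) ∧
      -- the full mechanism
      (∀ t : Tuning, IsDP (n := n) ((noise s ε').prod (gaussianNoise n s))
        (fullMechanism bin t) ε δ) := by
  refine ⟨?_, existsUnique_advEps_eq _ (hm.trans (Nat.le_add_right _ _)) hε hδ hδ1,
    exists_bounds_of_advEps_eq hε hδ hδ1, fun ε' hε' h => ?_⟩
  · rw [Fintype.card_sum, Fintype.card_fin, card_attrPair]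
  · have hstats : IsDP (n := n) (noise s ε') (noisyStats bin) ε δ :=
      h ▸ isDP_noisyStats hm bin hδ hδ1 hε'
    have := isProbabilityMeasure_noise s hε'
    refine ⟨isDP_noisyOne bin hε', fun j => (isDP_noisyOne bin hε' j).postprocess margin,
      isDP_noisyTwo bin hε', fun p => (isDP_noisyTwo bin hε' p).postprocess posConj, hstats,
      fun Ω' _ Q _ R' f => hstats.randomized_postprocess Q f, fun t => ?_⟩
    have : IsProbabilityMeasure (gaussianNoise n s) := by
      unfold gaussianNoise
      infer_instance
    -- `fullMechanism` reads the database only through `noisyStats`, with the normal variables as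
    -- independent coins; the values in `t` play no role.
    exact hstats.randomized_postprocess (gaussianNoise n s) (synthesize n t)
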